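/- Let $\omega$ be a non-principal ultrafilter on $\mathbb{N}$ and let $(n_k)_k$ be a sequence of positive integers with $n_k\to\infty$ (for example, any strictly increasing sequence). Let $X_\omega=\prod_k\{1,\dots,n_k\}/\!\sim$, where $(x_k)_k\sim(y_k)_k$ iff $\{k:x_k=y_k\}\in\omega$, equipped with the Loeb measure $\mu_\omega$: the (completed) Carathéodory extension, to the $\sigma$-algebra generated by the internal sets $\Pi_{k\to\omega}A_k=\{(x_k)_k: x_k\in A_k \text{ for } \omega\text{-almost all } k\}$, $A_k\subset\{1,\dots,n_k\}$, of $\mu_\omega(\Pi_{k\to\omega}A_k)=\lim_{k\to\omega}\mathrm{Card}(A_k)/n_k$. Let $X=[0,1]$ with Lebesgue measure $\mu$, let $St:X_\omega\to X$, $St((x_k)_k)=\lim_{k\to\omega}x_k/n_k$, be the standard part map, and let $St^*(L^\infty(X))=\{f\circ St: f\in L^\infty(X,\mu)\}\subset L^\infty(X_\omega,\mu_\omega)$ (complex-valued functions). Let $\Pi_{k\to\omega}Sym(n_k)$ be the universal sofic group, i.e. the quotient of $\prod_k Sym(n_k)$ by the normal subgroup of those $(p_k)_k$ with $\lim_{k\to\omega}\frac{1}{n_k}\mathrm{Card}\{i:p_k(i)\neq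 i\}=0$. The class $p$ of $(p_k)_k$ acts on $X_\omega$, up to $\mu_\omega$-null sets, by $p((x_k)_k)=(p_k(x_k))_k$, and on $L^\infty(X_\omega,\mu_\omega)$ by $p(f)(x)=f(p(x))$. We say that $p|_X$ exists and equals $\varphi:X\to X$ if $St(p(x))=\varphi(St(x))$ for $\mu_\omega$-almost all $x\in X_\omega$. Let $\mathcal{GA}$ be the set of those $p$ for which $p|_X$ exists and is an automorphism of $(X,\mu)$, i.e. a Lebesgue measurable, measure-preserving map which has a Lebesgue measurable, measure-preserving inverse up to null sets. Let $\Pi_{k\to\omega}M_{n_k}$ be the tracial ultraproduct, i.e. the ring of sequences $(a_k)_k$, $a_k\in M_{n_k}(\mathbb{C})$, that are bounded in operator norm, modulo the two-sided ideal of those with $\lim_{k\to\omega}\frac1{n_k}\mathrm{tr}(a_k^*a_k)=0$. Identify $\Pi_{k\to\omega}Sym(n_k)$ with the classes of sequences of permutation matrices, and $L^\infty(X_\omega,\mu_\omega)$ with the ultraproduct $\Pi_{k\to\omega}D_{n_k}$ of the diagonal subalgebras, the class of a bounded sequence $(\mathrm{diag}(d_k))_k$ corresponding to the function $(x_k)_k\mapsto\lim_{k\to\omega}d_k(x_k)$.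 **Theorem.** Let $p\in\Pi_{k\to\omega}Sym(n_k)$. Then $$p\in\mathcal{GA}\iff p\big(St^*(L^\infty(X))\big)=St^*(L^\infty(X)),$$ and likewise $p\in\mathcal{GA}$ if and only if $p$ is in the normaliser of $St^*(L^\infty(X))$ in $\Pi_{k\to\omega}M_{n_k}$, i.e. $p\,St^*(L^\infty(X))\,p^{-1}=St^*(L^\infty(X))$ under the above identifications. -/

import Mathlib

noncomputable section

namespace LoebSofic

open Filter Topology MeasureTheory
open scoped ENNReal unitInterval Matrix.Norms.L2Operator

/-! ### The Loeb space -/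

/-- The algebraic ultraproduct of the sets `{1, ..., n k}`. The set `{1, ..., n k}` is modelled by
`Fin (n k)`, where `i : Fin (n k)` stands for the integer `i + 1`. -/
def LoebSpace (n : ℕ → ℕ) (ω : Ultrafilter ℕ) : Type :=
  (ω : Filter ℕ).Product fun k => Fin (n k)

variable {n : ℕ → ℕ} {ω : Ultrafilter ℕ}

/-- The class of a sequence in the algebraic ultraproduct. -/
def LoebSpace.mk (ω : Ultrafilter ℕ) (x : ∀ k, Fin (n k)) : LoebSpace n ω :=
  Quotient.mk (productSetoid (ω : Filter ℕ) fun k => Fin (n k)) x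

theorem LoebSpace.ind {P : LoebSpace n ω → Prop} (h : ∀ x, P (LoebSpace.mk ω x)) (x) : P x :=
  Quotient.inductionOn x h

theorem LoebSpace.mk_eq {x y : ∀ k, Fin (n k)} :
    LoebSpace.mk ω x = LoebSpace.mk ω y ↔ ∀ᶠ k in (ω : Filter ℕ), x k = y k :=
  Quotient.eq (r := productSetoid (ω : Filter ℕ) fun k => Fin (n k))

/-- The internal set given by a sequence of sets `A k ⊆ {1, ..., n k}`. -/
def internalSet (ω : Ultrafilter ℕ) (A : ∀ k, Finset (Fin (n k))) : Set (LoebSpace n ω) :=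
  {z | ∃ x : ∀ k, Fin (n k), LoebSpace.mk ω x = z ∧ ∀ᶠ k in (ω : Filter ℕ), x k ∈ A k}

theorem mk_mem_internalSet {A : ∀ k, Finset (Fin (n k))} {x : ∀ k, Fin (n k)} :
    LoebSpace.mk ω x ∈ internalSet ω A ↔ ∀ᶠ k in (ω : Filter ℕ), x k ∈ A k := by
  constructor
  · rintro ⟨y, hy, hA⟩
    filter_upwards [LoebSpace.mk_eq.1 hy, hA] with k h1 h2
    exact h1 ▸ h2
  · exact fun h => ⟨x, rfl, h⟩

/-- The σ-algebra generated by the internal sets. -/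
instance : MeasurableSpace (LoebSpace n ω) :=
  MeasurableSpace.generateFrom (Set.range (internalSet ω))

/-- `lim_{k → ω} Card (A k) / n k`. The limit exists since `[0, ∞]` is compact. -/
def limDensity (ω : Ultrafilter ℕ) (A : ∀ k, Finset (Fin (n k))) : ℝ≥0∞ :=
  limUnder (ω : Filter ℕ) fun k => ((A k).card : ℝ≥0∞) / (n k : ℝ≥0∞)

/-- In a compact space every function has a limit along an ultrafilter. -/
theorem tendsto_limUnder_of_compact {Y : Type*} [TopologicalSpace Y] [CompactSpace Y] [Nonempty Y]
    (ω : Ultrafilter ℕ) (u : ℕ → Y) :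
    Tendsto u (ω : Filter ℕ) (𝓝 (limUnder (ω : Filter ℕ) u)) := by
  apply tendsto_nhds_limUnder
  obtain ⟨a, -, ha⟩ := isCompact_univ.ultrafilter_le_nhds (ω.map u) (by simp)
  exact ⟨a, ha⟩

theorem tendsto_limDensity (A : ∀ k, Finset (Fin (n k))) :
    Tendsto (fun k => ((A k).card : ℝ≥0∞) / (n k : ℝ≥0∞)) (ω : Filter ℕ) (𝓝 (limDensity ω A)) :=
  tendsto_limUnder_of_compact ω _

theorem limDensity_eq_zero {A : ∀ k, Finset (Fin (n k))}
    (h : Tendsto (fun k => ((A k).card : ℝ) / (n k : ℝ)) (ω : Filter ℕ) (𝓝 0)) :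
    limDensity ω A = 0 := by
  refine tendsto_nhds_unique (tendsto_limDensity A) ?_
  have h2 := ENNReal.tendsto_ofReal h
  rw [ENNReal.ofReal_zero] at h2
  refine h2.congr fun k => ?_
  rcases Nat.eq_zero_or_pos (n k) with h0 | h0
  · have : (A k).card = 0 := by
      have := (A k).card_le_univ
      simp only [Fintype.card_fin] at this
      omega
    simp [this]
  · rw [ENNReal.ofReal_div_of_pos (by exact_mod_cast h0)]
    simp

/-- The set function with value `lim_{k → ω} Card (A k) / n k` on the internal set given by `A`
(the value depends on the set only), and `∞` on sets that are not internal. -/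
def loebContent (n : ℕ → ℕ) (ω : Ultrafilter ℕ) (S : Set (LoebSpace n ω)) : ℝ≥0∞ :=
  ⨅ (A : ∀ k, Finset (Fin (n k))) (_ : S = internalSet ω A), limDensity ω A

theorem loebContent_internalSet_le (A : ∀ k, Finset (Fin (n k))) :
    loebContent n ω (internalSet ω A) ≤ limDensity ω A :=
  iInf₂_le_of_le A rfl le_rfl

theorem loebContent_empty : loebContent n ω ∅ = 0 := by
  have h : (∅ : Set (LoebSpace n ω)) = internalSet ω fun _ => ∅ := by
    ext z
    induction z using LoebSpace.ind with
    | h x => simp [mk_mem_internalSet, ω.neBot.ne]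
  refine le_antisymm ?_ bot_le
  rw [h]
  exact (loebContent_internalSet_le _).trans (limDensity_eq_zero (by simp)).le

/-- The Carathéodory outer measure of the premeasure on internal sets. -/
def loebOuter (n : ℕ → ℕ) (ω : Ultrafilter ℕ) : OuterMeasure (LoebSpace n ω) :=
  OuterMeasure.ofFunction (loebContent n ω) loebContent_empty

theorem measurableSpace_le_caratheodory :
    (inferInstance : MeasurableSpace (LoebSpace n ω)) ≤ (loebOuter n ω).caratheodory := by
  refine MeasurableSpace.generateFrom_le ?_
  rintro _ ⟨B, rfl⟩
  refine OuterMeasure.ofFunction_caratheodory fun t => ?_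
  refine le_iInf₂ fun A hA => ?_
  have h1 : t ∩ internalSet ω B = internalSet ω fun k => A k ∩ B k := by
    subst hA
    ext z
    induction z using LoebSpace.ind with
    | h x => simp [mk_mem_internalSet]
  have h2 : t \ internalSet ω B = internalSet ω fun k => A k \ B k := by
    subst hA
    ext z
    induction z using LoebSpace.ind with
    | h x =>
      simp only [Set.mem_sdiff, mk_mem_internalSet, Finset.mem_sdiff, eventually_and]
      rw [Ultrafilter.eventually_not]
  rw [h1, h2]
  refine (add_le_add (loebContent_internalSet_le _) (loebContent_internalSet_le _)).trans ?_
  refine (tendsto_nhds_unique ((tendsto_limDensity _).add (tendsto_limDensity _)) ?_).le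
  refine (tendsto_limDensity A).congr fun k => ?_
  rw [← ENNReal.add_div, ← Nat.cast_add, Finset.card_inter_add_card_sdiff]

/-- The Loeb measure `μ_ω`, on the σ-algebra generated by the internal sets. Null sets, "almost
everywhere" and `L^∞` are the same for it as for its completion. -/
def loebMeasure (n : ℕ → ℕ) (ω : Ultrafilter ℕ) : Measure (LoebSpace n ω) :=
  (loebOuter n ω).toMeasure measurableSpace_le_caratheodory

theorem loebMeasure_internalSet_le (A : ∀ k, Finset (Fin (n k))) :
    loebMeasure n ω (internalSet ω A) ≤ limDensity ω A := by
  have hA : MeasurableSet (internalSet ω A) :=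
    MeasurableSpace.measurableSet_generateFrom ⟨A, rfl⟩
  rw [loebMeasure, toMeasure_apply _ _ hA]
  exact (OuterMeasure.ofFunction_le _).trans (loebContent_internalSet_le A)

/-- The standard part `St ((x_k)_k) = lim_{k → ω} x_k / n_k`, with values in `[0, 1]`. -/
def St (x : LoebSpace n ω) : I :=
  Quotient.lift (s := productSetoid (ω : Filter ℕ) fun k => Fin (n k))
    (fun x : ∀ k, Fin (n k) => limUnder (ω : Filter ℕ) fun k =>
      (⟨((x k : ℕ) + 1 : ℝ) / (n k : ℝ), by positivity, by
        refine div_le_one_of_le₀ ?_ (by positivity)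
        exact_mod_cast (x k).isLt⟩ : I))
    (by
      intro x y h
      refine (tendsto_nhds_unique (tendsto_limUnder_of_compact ω _)
        ((tendsto_limUnder_of_compact ω _).congr' ?_))
      filter_upwards [show ∀ᶠ k in (ω : Filter ℕ), x k = y k from h] with k hk
      simp only [hk]) x

/-! ### The universal sofic group and its action -/

/-- The normalised Hamming distance of a permutation to the identity. -/
def hammingLength {m : ℕ} (s : Equiv.Perm (Fin m)) : ℝ := (s.support.card : ℝ) / (m : ℝ)

/-- The normal subgroup of the sequences of permutations whose normalised Hamming distance to the
identity tends to `0` along `ω`. -/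
def hammingNull (n : ℕ → ℕ) (ω : Ultrafilter ℕ) : Subgroup (∀ k, Equiv.Perm (Fin (n k))) where
  carrier := {p | Tendsto (fun k => hammingLength (p k)) (ω : Filter ℕ) (𝓝 0)}
  one_mem' := by simp [hammingLength]
  inv_mem' := by
    intro p hp
    simpa [hammingLength, Equiv.Perm.support_inv] using hp
  mul_mem' := by
    intro p q hp hq
    have h := Tendsto.add hp hq
    rw [add_zero] at h
    refine squeeze_zero (fun k => by unfold hammingLength; positivity) (fun k => ?_) h
    simp only [hammingLength, Pi.mul_apply, ← add_div]
    gcongr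
    have h1 : (p k * q k).support.card ≤ (p k).support.card + (q k).support.card :=
      (Finset.card_le_card (Equiv.Perm.support_mul_le _ _)).trans (Finset.card_union_le _ _)
    exact_mod_cast h1

instance : (hammingNull n ω).Normal where
  conj_mem := by
    intro p hp g
    change Tendsto _ _ _
    simpa [hammingLength, Equiv.Perm.card_support_conj] using
      (show Tendsto (fun k => hammingLength (p k)) (ω : Filter ℕ) (𝓝 0) from hp)

/-- The universal sofic group, i.e. the metric ultraproduct of the groups `Sym (n k)`. -/
def SoficGroup (n : ℕ → ℕ) (ω : Ultrafilter ℕ) : Type :=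
  (∀ k, Equiv.Perm (Fin (n k))) ⧸ hammingNull n ω

instance : Group (SoficGroup n ω) := QuotientGroup.Quotient.group (hammingNull n ω)

/-- The map `(x_k)_k ↦ (p_k (x_k))_k` of the Loeb space. -/
def loebMap (ω : Ultrafilter ℕ) (p : ∀ k, Equiv.Perm (Fin (n k))) :
    LoebSpace n ω → LoebSpace n ω :=
  Quotient.map' (s₁ := productSetoid (ω : Filter ℕ) fun k => Fin (n k))
    (s₂ := productSetoid (ω : Filter ℕ) fun k => Fin (n k)) (fun x k => p k (x k)) (by
      intro x y h
      filter_upwards [show ∀ᶠ k in (ω : Filter ℕ), x k = y k from h] with k hk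
      rw [hk])

theorem loebMap_mk (p : ∀ k, Equiv.Perm (Fin (n k))) (x : ∀ k, Fin (n k)) :
    loebMap ω p (LoebSpace.mk ω x) = LoebSpace.mk ω fun k => p k (x k) := rfl

theorem loebMap_preimage_internalSet (p : ∀ k, Equiv.Perm (Fin (n k)))
    (A : ∀ k, Finset (Fin (n k))) :
    loebMap ω p ⁻¹' internalSet ω A =
      internalSet ω fun k => (A k).map (p k)⁻¹.toEmbedding := by
  ext z
  induction z using LoebSpace.ind with
  | h x =>
    rw [Set.mem_preimage, loebMap_mk, mk_mem_internalSet, mk_mem_internalSet]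
    refine eventually_congr (Eventually.of_forall fun k => ?_)
    simp only [Finset.mem_map, Equiv.coe_toEmbedding]
    exact ⟨fun h => ⟨_, h, by simp⟩, fun ⟨a, ha, h⟩ => by rw [← h]; simpa using ha⟩

theorem loebOuter_preimage_le (p : ∀ k, Equiv.Perm (Fin (n k))) (s : Set (LoebSpace n ω)) :
    loebOuter n ω (loebMap ω p ⁻¹' s) ≤ loebOuter n ω s := by
  have h : OuterMeasure.map (loebMap ω p) (loebOuter n ω) ≤ loebOuter n ω := by
    refine OuterMeasure.le_ofFunction.2 fun t => ?_
    rw [OuterMeasure.map_apply]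
    refine (OuterMeasure.ofFunction_le _).trans (le_iInf₂ fun A hA => ?_)
    rw [hA, loebMap_preimage_internalSet]
    refine (loebContent_internalSet_le _).trans_eq ?_
    simp [limDensity]
  simpa using h s

theorem measurePreserving_loebMap (p : ∀ k, Equiv.Perm (Fin (n k))) :
    MeasurePreserving (loebMap ω p) (loebMeasure n ω) (loebMeasure n ω) := by
  have hm : Measurable (loebMap ω p) := by
    refine measurable_generateFrom ?_
    rintro _ ⟨A, rfl⟩
    rw [loebMap_preimage_internalSet]
    exact MeasurableSpace.measurableSet_generateFrom ⟨_, rfl⟩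
  refine ⟨hm, Measure.ext fun s hs => ?_⟩
  rw [Measure.map_apply hm hs, loebMeasure, toMeasure_apply _ _ (hm hs), toMeasure_apply _ _ hs]
  refine le_antisymm (loebOuter_preimage_le p s) ?_
  have h : s = loebMap ω p⁻¹ ⁻¹' (loebMap ω p ⁻¹' s) := by
    ext z
    induction z using LoebSpace.ind with
    | h x => simp [loebMap_mk]
  calc loebOuter n ω s = loebOuter n ω (loebMap ω p⁻¹ ⁻¹' (loebMap ω p ⁻¹' s)) := by rw [← h]
    _ ≤ _ := loebOuter_preimage_le _ _

/-- Sequences of permutations with the same class in the universal sofic group act by maps that are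
equal almost everywhere. -/
theorem loebMap_ae_eq {p q : ∀ k, Equiv.Perm (Fin (n k))} (h : p⁻¹ * q ∈ hammingNull n ω) :
    loebMap ω p =ᵐ[loebMeasure n ω] loebMap ω q := by
  have h0 : loebMeasure n ω (internalSet ω fun k => (p⁻¹ * q) k |>.support) = 0 :=
    le_antisymm ((loebMeasure_internalSet_le _).trans (limDensity_eq_zero (show Tendsto
      (fun k => hammingLength ((p⁻¹ * q) k)) (ω : Filter ℕ) (𝓝 0) from h)).le) bot_le
  refine measure_mono_null (fun z hz => ?_) h0
  induction z using LoebSpace.ind with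
  | h x =>
    rw [mk_mem_internalSet]
    have h1 : ¬ loebMap ω p (LoebSpace.mk ω x) = loebMap ω q (LoebSpace.mk ω x) := hz
    rw [loebMap_mk, loebMap_mk, LoebSpace.mk_eq, ← Ultrafilter.eventually_not] at h1
    filter_upwards [h1] with k hk
    rw [Equiv.Perm.mem_support]
    intro h2
    apply hk
    have h3 : (p k)⁻¹ (q k (x k)) = x k := h2
    rw [Equiv.Perm.inv_eq_iff_eq] at h3
    exact h3.symm

/-- The algebra `L^∞` of the Loeb space. -/
abbrev LoebLinfty (n : ℕ → ℕ) (ω : Ultrafilter ℕ) : Type :=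
  Lp ℂ ∞ (loebMeasure n ω)

/-- The action `p (f) (x) = f (p (x))` of the universal sofic group on `L^∞` of the Loeb space. -/
def soficAct (p : SoficGroup n ω) : LoebLinfty n ω → LoebLinfty n ω :=
  Quotient.liftOn' p
    (fun q => Lp.compMeasurePreserving (loebMap ω q) (measurePreserving_loebMap q))
    (by
      intro p q h
      funext f
      have hpq := loebMap_ae_eq (QuotientGroup.leftRel_apply.1 h)
      refine Lp.ext ?_
      refine (Lp.coeFn_compMeasurePreserving f (measurePreserving_loebMap p)).trans
        (EventuallyEq.trans ?_ (Lp.coeFn_compMeasurePreserving f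
          (measurePreserving_loebMap q)).symm)
      filter_upwards [hpq] with x hx
      simp [hx])

/-- `p|_X` exists and is equal to `φ`, i.e. `St (p (x)) = φ (St (x))` for almost all `x`. -/
def IsRestriction (p : SoficGroup n ω) (φ : I → I) : Prop :=
  Quotient.liftOn' p
    (fun q => ∀ᵐ x ∂(loebMeasure n ω), St (loebMap ω q x) = φ (St x))
    (by
      intro p q h
      have hpq := loebMap_ae_eq (QuotientGroup.leftRel_apply.1 h)
      refine propext (eventually_congr ?_)
      filter_upwards [hpq] with x hx
      rw [hx])

/-- `φ` preserves the Lebesgue measure of `[0, 1]`. Measurability is with respect to the Lebesgue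
measurable sets, which for a map into `[0, 1]` is `AEMeasurable`. -/
def IsMeasurePreservingMap (φ : I → I) : Prop :=
  AEMeasurable φ volume ∧ Measure.map φ volume = volume

/-- `φ` is an automorphism of the unit interval with the Lebesgue measure: a measure preserving map
with a measure preserving inverse, where maps are considered up to null sets. -/
def IsAutomorphism (φ : I → I) : Prop :=
  IsMeasurePreservingMap φ ∧ ∃ ψ : I → I, IsMeasurePreservingMap ψ ∧
    (∀ᵐ x ∂(volume : Measure I), ψ (φ x) = x) ∧ (∀ᵐ x ∂(volume : Measure I), φ (ψ x) = x)

/-- The set of the elements `p` for which `p|_X` exists and is an automorphism. -/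
def GA (n : ℕ → ℕ) (ω : Ultrafilter ℕ) : Set (SoficGroup n ω) :=
  {p | ∃ φ : I → I, IsRestriction p φ ∧ IsAutomorphism φ}

/-- The subalgebra `St* (L^∞ [0, 1]) = {f ∘ St : f ∈ L^∞ [0, 1]}`. -/
def StAlg (n : ℕ → ℕ) (ω : Ultrafilter ℕ) : Set (LoebLinfty n ω) :=
  {F | ∃ f : Lp ℂ ∞ (volume : Measure I), F =ᵐ[loebMeasure n ω] fun x => f (St x)}

/-! ### The tracial ultraproduct of matrix algebras -/

/-- The sequences of matrices that are bounded in operator norm. -/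
def boundedSeq (n : ℕ → ℕ) : Subring (∀ k, Matrix (Fin (n k)) (Fin (n k)) ℂ) where
  carrier := {a | ∃ C : ℝ, ∀ k, ‖a k‖ ≤ C}
  zero_mem' := ⟨0, by simp⟩
  one_mem' := ⟨1, fun k => by
    simpa using Matrix.permMatrix_l2_opNorm_le (𝕜 := ℂ) (1 : Equiv.Perm (Fin (n k)))⟩
  neg_mem' := by
    rintro a ⟨C, hC⟩
    exact ⟨C, fun k => by simpa using hC k⟩
  add_mem' := by
    rintro a b ⟨C, hC⟩ ⟨D, hD⟩
    exact ⟨C + D, fun k => (norm_add_le _ _).trans (add_le_add (hC k) (hD k))⟩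
  mul_mem' := by
    rintro a b ⟨C, hC⟩ ⟨D, hD⟩
    exact ⟨C * D, fun k => (norm_mul_le _ _).trans
      (mul_le_mul (hC k) (hD k) (norm_nonneg _) ((norm_nonneg _).trans (hC k)))⟩

/-- The square `Tr (a* a) = (1 / m) ∑ |a_ij|²` of the norm given by the normalised trace. -/
def traceNormSq {m : ℕ} (a : Matrix (Fin m) (Fin m) ℂ) : ℝ :=
  (∑ j, ∑ i, ‖a i j‖ ^ 2) / (m : ℝ)

theorem traceNormSq_nonneg {m : ℕ} (a : Matrix (Fin m) (Fin m) ℂ) : 0 ≤ traceNormSq a := by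
  unfold traceNormSq; positivity

theorem traceNormSq_conjTranspose {m : ℕ} (a : Matrix (Fin m) (Fin m) ℂ) :
    traceNormSq a.conjTranspose = traceNormSq a := by
  simp only [traceNormSq, Matrix.conjTranspose_apply, norm_star]
  rw [Finset.sum_comm]

theorem traceNormSq_mul_le {m : ℕ} (b a : Matrix (Fin m) (Fin m) ℂ) :
    traceNormSq (b * a) ≤ ‖b‖ ^ 2 * traceNormSq a := by
  unfold traceNormSq
  rw [← mul_div_assoc, Finset.mul_sum]
  gcongr with j
  have h := Matrix.l2_opNorm_mulVec b (WithLp.toLp 2 fun i => a i j)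
  have h2 := pow_le_pow_left₀ (norm_nonneg _) h 2
  rw [mul_pow, EuclideanSpace.norm_sq_eq, EuclideanSpace.norm_sq_eq] at h2
  exact h2

theorem traceNormSq_mul_le' {m : ℕ} (a b : Matrix (Fin m) (Fin m) ℂ) :
    traceNormSq (a * b) ≤ ‖b‖ ^ 2 * traceNormSq a := by
  rw [← traceNormSq_conjTranspose, Matrix.conjTranspose_mul, ← traceNormSq_conjTranspose a,
    ← Matrix.l2_opNorm_conjTranspose b]
  exact traceNormSq_mul_le _ _

theorem traceNormSq_add_le {m : ℕ} (a b : Matrix (Fin m) (Fin m) ℂ) :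
    traceNormSq (a + b) ≤ 2 * traceNormSq a + 2 * traceNormSq b := by
  unfold traceNormSq
  rw [← mul_div_assoc, ← mul_div_assoc, ← add_div, Finset.mul_sum, Finset.mul_sum,
    ← Finset.sum_add_distrib]
  gcongr with j
  rw [Finset.mul_sum, Finset.mul_sum, ← Finset.sum_add_distrib]
  gcongr with i
  have h := pow_le_pow_left₀ (norm_nonneg _) (norm_add_le (a i j) (b i j)) 2
  simp only [Matrix.add_apply]
  nlinarith [sq_nonneg (‖a i j‖ - ‖b i j‖)]

/-- The two-sided ideal of the bounded sequences that tend to `0` along `ω` in the norm given by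
the normalised trace. -/
def traceNull (n : ℕ → ℕ) (ω : Ultrafilter ℕ) : Ideal (boundedSeq n) where
  carrier := {a | Tendsto (fun k => traceNormSq (a.1 k)) (ω : Filter ℕ) (𝓝 0)}
  zero_mem' := by simp [traceNormSq]
  add_mem' := by
    intro a b ha hb
    have h := (Tendsto.const_mul 2 ha).add (Tendsto.const_mul 2 hb)
    rw [mul_zero, add_zero] at h
    exact squeeze_zero (fun k => traceNormSq_nonneg _) (fun k => traceNormSq_add_le _ _) h
  smul_mem' := by
    rintro ⟨b, C, hC⟩ a ha
    have h := Tendsto.const_mul (C ^ 2) ha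
    rw [mul_zero] at h
    refine squeeze_zero (fun k => traceNormSq_nonneg _) (fun k => ?_) h
    refine (traceNormSq_mul_le (b k) (a.1 k)).trans ?_
    have := hC k
    have := traceNormSq_nonneg (a.1 k)
    gcongr

instance : (traceNull n ω).IsTwoSided where
  mul_mem_of_left := by
    rintro a ⟨b, C, hC⟩ ha
    have h := Tendsto.const_mul (C ^ 2)
      (show Tendsto (fun k => traceNormSq (a.1 k)) (ω : Filter ℕ) (𝓝 0) from ha)
    rw [mul_zero] at h
    refine squeeze_zero (fun k => traceNormSq_nonneg _) (fun k => ?_) h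
    refine (traceNormSq_mul_le' (a.1 k) (b k)).trans ?_
    have := hC k
    have := traceNormSq_nonneg (a.1 k)
    gcongr

/-- The tracial ultraproduct of the matrix algebras `M_{n k}`. -/
def MatrixUltraproduct (n : ℕ → ℕ) (ω : Ultrafilter ℕ) : Type :=
  boundedSeq n ⧸ traceNull n ω

instance : Ring (MatrixUltraproduct n ω) := Ideal.Quotient.ring (traceNull n ω)

/-- The class of a bounded sequence of matrices in the tracial ultraproduct. -/
def MatrixUltraproduct.mk (n : ℕ → ℕ) (ω : Ultrafilter ℕ) :
    boundedSeq n →+* MatrixUltraproduct n ω :=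
  Ideal.Quotient.mk (traceNull n ω)

theorem MatrixUltraproduct.mk_eq {a b : boundedSeq n} (h : a - b ∈ traceNull n ω) :
    MatrixUltraproduct.mk n ω a = MatrixUltraproduct.mk n ω b :=
  Ideal.Quotient.eq.2 h

/-- The sequence of permutation matrices of a sequence of permutations; the permutation matrix of
`s` sends the basis vector `e_i` to `e_{s i}`. -/
def permSeq (n : ℕ → ℕ) : (∀ k, Equiv.Perm (Fin (n k))) →* boundedSeq n where
  toFun p := ⟨fun k => Matrix.permMatrixHom (p k), 1, fun k => by
    simpa using Matrix.permMatrix_l2_opNorm_le (𝕜 := ℂ) (p k)⁻¹⟩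
  map_one' := by ext1; funext k; simp
  map_mul' p q := by ext1; funext k; simp

theorem traceNormSq_permMatrixHom_sub_one_le {m : ℕ} (s : Equiv.Perm (Fin m)) :
    traceNormSq (Matrix.permMatrixHom s - 1 : Matrix (Fin m) (Fin m) ℂ) ≤
      2 * hammingLength s := by
  unfold traceNormSq hammingLength
  rw [← mul_div_assoc]
  gcongr
  have h : ∀ j, ∑ i, ‖(Matrix.permMatrixHom s - 1 : Matrix (Fin m) (Fin m) ℂ) i j‖ ^ 2 ≤
      if j ∈ s.support then 2 else 0 := by
    intro j
    have h1 : ∀ i, (Matrix.permMatrixHom s - 1 : Matrix (Fin m) (Fin m) ℂ) i j =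
        (if i = s j then 1 else 0) - (if i = j then 1 else 0) := by
      intro i
      rw [Matrix.sub_apply, Matrix.permMatrixHom_apply, Matrix.one_apply, Equiv.Perm.permMatrix,
        PEquiv.toMatrix_apply]
      congr 1
      refine if_congr ?_ rfl rfl
      simp only [Equiv.toPEquiv_apply, Option.mem_some_iff]
      exact Equiv.Perm.inv_eq_iff_eq
    split_ifs with hj
    · calc _ ≤ ∑ i, ((if i = s j then (1 : ℝ) else 0) + (if i = j then 1 else 0)) := by
            refine Finset.sum_le_sum fun i _ => ?_
            rw [h1]
            split_ifs <;> norm_num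
        _ = 2 := by
            rw [Finset.sum_add_distrib]
            simp
            norm_num
    · rw [Equiv.Perm.notMem_support] at hj
      simp only [h1, hj, sub_self]
      simp
  refine (Finset.sum_le_sum fun j _ => h j).trans_eq ?_
  rw [← Finset.sum_filter, Finset.sum_const, nsmul_eq_mul, mul_comm]
  congr 2
  simp [Equiv.Perm.support]

/-- The identification of the universal sofic group with the group of the classes of sequences of
permutation matrices. -/
def permUnit (n : ℕ → ℕ) (ω : Ultrafilter ℕ) : SoficGroup n ω →* (MatrixUltraproduct n ω)ˣ :=
  QuotientGroup.lift (hammingNull n ω)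
    (MonoidHom.toHomUnits
      ((MatrixUltraproduct.mk n ω : boundedSeq n →* MatrixUltraproduct n ω).comp (permSeq n)))
    (by
      intro p hp
      have h := Tendsto.const_mul 2
        (show Tendsto (fun k => hammingLength (p k)) (ω : Filter ℕ) (𝓝 0) from hp)
      rw [mul_zero] at h
      refine Units.ext ?_
      refine (MatrixUltraproduct.mk_eq (b := 1) ?_).trans (map_one _)
      exact squeeze_zero (fun k => traceNormSq_nonneg _)
        (fun k => traceNormSq_permMatrixHom_sub_one_le (p k)) h)

/-- The sequence of diagonal matrices given by a bounded sequence of diagonals. -/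
def diagSeq (d : ∀ k, Fin (n k) → ℂ) (hd : ∃ C : ℝ, ∀ k i, ‖d k i‖ ≤ C) : boundedSeq n :=
  ⟨fun k => Matrix.diagonal (d k), by
    obtain ⟨C, hC⟩ := hd
    refine ⟨max C 0, fun k => ?_⟩
    rw [Matrix.l2_opNorm_diagonal]
    exact (pi_norm_le_iff_of_nonneg (le_max_right _ _)).2 fun i => (hC k i).trans (le_max_left _ _)⟩

/-- The function `(x_k)_k ↦ lim_{k → ω} d_k (x_k)` on the Loeb space given by a bounded sequence of
functions (the limit exists since the sequence is bounded). -/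
def loebFunction (ω : Ultrafilter ℕ) (d : ∀ k, Fin (n k) → ℂ) (x : LoebSpace n ω) : ℂ :=
  Quotient.lift (s := productSetoid (ω : Filter ℕ) fun k => Fin (n k))
    (fun x : ∀ k, Fin (n k) => limUnder (ω : Filter ℕ) fun k => d k (x k))
    (by
      intro x y h
      refine congrArg lim (Filter.map_congr ?_)
      filter_upwards [show ∀ᶠ k in (ω : Filter ℕ), x k = y k from h] with k hk
      rw [hk]) x

/-- The image of a set of functions under the isomorphism of `L^∞` of the Loeb space with the
ultraproduct of the diagonal algebras, seen in the ultraproduct of the matrix algebras: the class of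
a bounded sequence of diagonal matrices `diag (d_k)` corresponds to the function
`(x_k)_k ↦ lim_{k → ω} d_k (x_k)`. -/
def diagImage (S : Set (LoebLinfty n ω)) : Set (MatrixUltraproduct n ω) :=
  {a | ∃ (d : ∀ k, Fin (n k) → ℂ) (hd : ∃ C : ℝ, ∀ k i, ‖d k i‖ ≤ C),
    a = MatrixUltraproduct.mk n ω (diagSeq d hd) ∧
      ∃ F ∈ S, F =ᵐ[loebMeasure n ω] loebFunction ω d}

/-- The unit `u` is in the normaliser of the set `A`. -/
def Normalises {R : Type*} [Ring R] (u : Rˣ) (A : Set R) : Prop :=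
  (fun a : R => (u : R) * a * ((u⁻¹ : Rˣ) : R)) '' A = A

end LoebSofic

end

noncomputable section

namespace LoebSofic

open Filter Topology MeasureTheory
open scoped ENNReal unitInterval Matrix.Norms.L2Operator

variable {n : ℕ → ℕ} {ω : Ultrafilter ℕ}

/-! ### The Loeb measure is a probability measure -/

/-! Everything rests on `St` pushing the Loeb measure forward to Lebesgue measure
(`measurePreserving_St`): statements that hold almost everywhere on `[0,1]` can then be pulled back
along `St`, and measurable ones pushed forward.

If `p|_X = φ`, then `p (f ∘ St) = f ∘ φ ∘ St`, so `p` maps `St* (L^∞)` into itself when `φ`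
preserves the measure. Membership in `GA` passes to `p⁻¹`, which upgrades the inclusion to an
equality.

Conversely, one function is enough to test: the coordinate function, whose pullback is `St` itself.
If `St ∘ p` lies in the algebra, it equals `φ ∘ St` almost everywhere for a measurable `φ`, which is
precisely the existence of `p|_X`. The same test on `p⁻¹` gives `ψ`. That `φ` and `ψ` preserve the
measure and are mutually inverse follows from the corresponding facts about `p` and `p⁻¹`
(`mem_GA_of_soficAct_stElement_mem`).

For matrices, conjugating `diag (d_k)` by the permutation matrix of `p_k` gives `diag (d_k ∘
p_k⁻¹)`, so conjugation by `p` is the action of `p⁻¹`. To return from classes of matrices to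
functions one needs that a class determines its function almost everywhere (`loebFunction_ae_eq`).
-/

theorem internalSet_univ :
    internalSet ω (fun k => (Finset.univ : Finset (Fin (n k)))) = Set.univ := by
  ext z
  induction z using LoebSpace.ind with
  | h x => simp [mk_mem_internalSet]

/-- Countable saturation: countably many internal sets of total density less than `1` do not cover
the Loeb space. -/
theorem exists_notMem_iUnion_internalSet (hω : (ω : Filter ℕ) ≤ cofinite) (hpos : ∀ k, 0 < n k)
    (A : ℕ → ∀ k, Finset (Fin (n k))) (hA : ∑' j, limDensity ω (A j) < 1) :
    ∃ z : LoebSpace n ω, ∀ j, z ∉ internalSet ω (A j) := by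
  classical
  let P : ℕ → ℕ → Prop := fun k m => ∃ x : Fin (n k), ∀ j < m, x ∉ A j k
  have hP0 : ∀ k, P k 0 := fun k => ⟨⟨0, hpos k⟩, by simp⟩
  -- Union bound: `m` of the sets can cover `{1, ..., n k}` only if their densities at `k` sum to at
  -- least `1`.
  have hP : ∀ m, ∀ᶠ k in (ω : Filter ℕ), P k m := by
    intro m
    have h1 : Tendsto (fun k => ∑ j ∈ Finset.range m, ((A j k).card : ℝ≥0∞) / (n k : ℝ≥0∞))
        (ω : Filter ℕ) (𝓝 (∑ j ∈ Finset.range m, limDensity ω (A j))) :=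
      tendsto_finsetSum _ fun j _ => tendsto_limDensity (A j)
    have h2 : ∑ j ∈ Finset.range m, limDensity ω (A j) < 1 := (ENNReal.sum_le_tsum _).trans_lt hA
    filter_upwards [h1.eventually_lt_const h2] with k hk
    by_contra hcon
    simp only [P, not_exists, not_forall, not_not] at hcon
    have h3 : (Finset.univ : Finset (Fin (n k))) ⊆ (Finset.range m).biUnion fun j => A j k := by
      intro x _
      obtain ⟨j, hj, hx⟩ := hcon x
      exact Finset.mem_biUnion.2 ⟨j, Finset.mem_range.2 hj, hx⟩
    have h4 : n k ≤ ∑ j ∈ Finset.range m, (A j k).card := by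
      simpa using (Finset.card_le_card h3).trans Finset.card_biUnion_le
    have h5 : (1 : ℝ≥0∞) ≤ ∑ j ∈ Finset.range m, ((A j k).card : ℝ≥0∞) / (n k : ℝ≥0∞) := by
      simp only [div_eq_mul_inv, ← Finset.sum_mul]
      rw [← div_eq_mul_inv, ENNReal.le_div_iff_mul_le (Or.inl (by simpa using (hpos k).ne'))
        (Or.inl (ENNReal.natCast_ne_top _)), one_mul]
      exact_mod_cast h4
    exact absurd hk (not_lt.2 h5)
  -- Diagonal choice: the point at index `k` avoids the longest initial segment of the sets that can
  -- be avoided, of length capped at `k`. The cap is harmless because `ω` is non-principal, so `k ≥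
  -- j + 1` for `ω`-almost all `k`.
  have hsel : ∀ k, P k (Nat.findGreatest (P k) k) := fun k =>
    Nat.findGreatest_spec (P := P k) (Nat.zero_le k) (hP0 k)
  choose x hx using hsel
  refine ⟨LoebSpace.mk ω x, fun j => ?_⟩
  rw [mk_mem_internalSet, ← Ultrafilter.eventually_not]
  have hge : ∀ᶠ k in (ω : Filter ℕ), j + 1 ≤ k :=
    hω (Nat.cofinite_eq_atTop ▸ eventually_ge_atTop (j + 1))
  filter_upwards [hP (j + 1), hge] with k hk hjk
  exact hx k j (Nat.le_findGreatest hjk hk)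

/-- The bound `≥ 1` is where saturation enters: a countable cover of total content less than `1`
must consist of internal sets, and such a cover misses a point. With total mass `1` known, upper
bounds for the measures of internal sets suffice later on, lower bounds coming from complements. -/
theorem isProbabilityMeasure_loebMeasure (hω : (ω : Filter ℕ) ≤ cofinite) (hpos : ∀ k, 0 < n k) :
    IsProbabilityMeasure (loebMeasure n ω) := by
  refine ⟨le_antisymm ?_ ?_⟩
  · rw [← internalSet_univ]
    refine (loebMeasure_internalSet_le _).trans_eq ?_
    refine tendsto_nhds_unique (tendsto_limDensity _) (tendsto_const_nhds.congr fun k => ?_)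
    rw [Finset.card_univ, Fintype.card_fin, ENNReal.div_self (by simpa using (hpos k).ne')
      (ENNReal.natCast_ne_top _)]
  · rw [loebMeasure, toMeasure_apply _ _ MeasurableSet.univ, loebOuter, OuterMeasure.ofFunction_apply]
    refine le_iInf₂ fun t ht => ?_
    by_contra! hlt
    -- The content is an infimum over representing sequences, so each representative costs an error
    -- `δ j`; the errors together stay below the gap to `1`.
    obtain ⟨δ, hδ, hsum⟩ := ENNReal.exists_pos_sum_of_countable'
      (tsub_pos_of_lt hlt).ne' ℕ
    have hex : ∀ j, ∃ A : ∀ k, Finset (Fin (n k)), t j = internalSet ω A ∧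
        limDensity ω A ≤ loebContent n ω (t j) + δ j := by
      intro j
      have h1 : loebContent n ω (t j) < loebContent n ω (t j) + δ j :=
        ENNReal.lt_add_right ((ENNReal.le_tsum j).trans_lt (hlt.trans ENNReal.one_lt_top)).ne
          (hδ j).ne'
      nth_rw 1 [loebContent] at h1
      obtain ⟨A, hA⟩ := iInf_lt_iff.1 h1
      obtain ⟨h2, h3⟩ := iInf_lt_iff.1 hA
      exact ⟨A, h2, h3.le⟩
    choose A hA hle using hex
    obtain ⟨z, hz⟩ := exists_notMem_iUnion_internalSet hω hpos A (by
      calc ∑' j, limDensity ω (A j) ≤ ∑' j, (loebContent n ω (t j) + δ j) :=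
            ENNReal.tsum_le_tsum hle
        _ = ∑' j, loebContent n ω (t j) + ∑' j, δ j := ENNReal.tsum_add
        _ < _ := lt_tsub_iff_left.1 hsum)
    obtain ⟨j, hj⟩ := Set.mem_iUnion.1 (ht (Set.mem_univ z))
    exact hz j (hA j ▸ hj)

/-! ### The standard part map preserves the measure -/

theorem tendsto_St (x : ∀ k, Fin (n k)) :
    Tendsto (fun k => ((x k : ℕ) + 1 : ℝ) / (n k : ℝ)) (ω : Filter ℕ)
      (𝓝 (St (LoebSpace.mk ω x) : ℝ)) :=
  (continuous_subtype_val.tendsto _).comp (tendsto_limUnder_of_compact ω fun k =>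
    (⟨((x k : ℕ) + 1 : ℝ) / (n k : ℝ), by positivity, by
      refine div_le_one_of_le₀ ?_ (by positivity)
      exact_mod_cast (x k).isLt⟩ : I))

/-- The points of `{1, ..., m}` whose quotient by `m` is greater than `a`. -/
def upperPart (m : ℕ) (a : ℝ) : Finset (Fin m) := {i | a < ((i : ℕ) + 1 : ℝ) / (m : ℝ)}

/-- The points of `{1, ..., m}` whose quotient by `m` is less than `a`. -/
def lowerPart (m : ℕ) (a : ℝ) : Finset (Fin m) := {i | ((i : ℕ) + 1 : ℝ) / (m : ℝ) < a}

/-- The additive `1` is the rounding error; it disappears after division by `n k → ∞` in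
`limDensity_le_ofReal`. -/
theorem card_upperPart_le {m : ℕ} (hm : 0 < m) {a : ℝ} (h0 : 0 ≤ a) (h1 : a ≤ 1) :
    ((upperPart m a).card : ℝ) ≤ (1 - a) * m + 1 := by
  have hm' : (0 : ℝ) < m := by exact_mod_cast hm
  have hf : ⌊a * m⌋₊ ≤ m := by
    refine Nat.floor_le_of_le ?_
    nlinarith
  have h : (upperPart m a).card ≤ (Finset.Ico ⌊a * m⌋₊ m).card := by
    refine Finset.card_le_card_of_injOn (fun i => (i : ℕ)) (fun i hi => ?_)
      (fun i _ j _ hij => Fin.ext hij)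
    simp only [upperPart, Finset.coe_filter, Finset.mem_univ, true_and, Set.mem_ofPred_eq] at hi
    rw [lt_div_iff₀ hm'] at hi
    simp only [Finset.coe_Ico, Set.mem_Ico, i.isLt, and_true]
    -- The index `i` stands for the integer `i + 1`, so `a * m < i + 1` gives `⌊a * m⌋₊ ≤ i`.
    refine Nat.lt_add_one_iff.1 ((Nat.floor_lt (by positivity)).2 ?_)
    exact_mod_cast hi
  rw [Nat.card_Ico] at h
  have h' : ((upperPart m a).card : ℝ) ≤ (m : ℝ) - ⌊a * m⌋₊ := by
    rw [← Nat.cast_sub hf]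
    exact_mod_cast h
  have := Nat.lt_floor_add_one (a * m)
  linarith

theorem card_lowerPart_le {m : ℕ} (hm : 0 < m) {a : ℝ} (h0 : 0 ≤ a) :
    ((lowerPart m a).card : ℝ) ≤ a * m + 1 := by
  have hm' : (0 : ℝ) < m := by exact_mod_cast hm
  have h : (lowerPart m a).card ≤ (Finset.range ⌈a * m⌉₊).card := by
    refine Finset.card_le_card_of_injOn (fun i => (i : ℕ)) (fun i hi => ?_)
      (fun i _ j _ hij => Fin.ext hij)
    simp only [lowerPart, Finset.coe_filter, Finset.mem_univ, true_and, Set.mem_ofPred_eq] at hi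
    rw [div_lt_iff₀ hm'] at hi
    simp only [Finset.coe_range, Set.mem_Iio]
    refine Nat.lt_ceil.2 ?_
    linarith
  rw [Finset.card_range] at h
  have h' : ((lowerPart m a).card : ℝ) ≤ ⌈a * m⌉₊ := by exact_mod_cast h
  have := Nat.ceil_lt_add_one (a := a * m) (by positivity)
  linarith

theorem limDensity_le_ofReal (hω : (ω : Filter ℕ) ≤ cofinite) (hpos : ∀ k, 0 < n k)
    (hn : Tendsto n atTop atTop) {A : ∀ k, Finset (Fin (n k))} {c : ℝ}
    (hA : ∀ k, ((A k).card : ℝ) ≤ c * n k + 1) : limDensity ω A ≤ ENNReal.ofReal c := by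
  have h1 : Tendsto (fun k => c + ((n k : ℝ))⁻¹) (ω : Filter ℕ) (𝓝 (c + 0)) :=
    tendsto_const_nhds.add (tendsto_inv_atTop_zero.comp
      (tendsto_natCast_atTop_atTop.comp (hn.mono_left (hω.trans Nat.cofinite_eq_atTop.le))))
  rw [add_zero] at h1
  refine le_of_tendsto_of_tendsto' (tendsto_limDensity A) (ENNReal.tendsto_ofReal h1) fun k => ?_
  have hk : (0 : ℝ) < n k := by exact_mod_cast hpos k
  have h2 : ((A k).card : ℝ) / n k ≤ c + ((n k : ℝ))⁻¹ := by
    rw [div_le_iff₀ hk, add_mul, inv_mul_cancel₀ hk.ne']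
    exact hA k
  refine le_trans (le_of_eq ?_) (ENNReal.ofReal_le_ofReal h2)
  rw [ENNReal.ofReal_div_of_pos hk]
  simp

theorem measurable_St : Measurable (St : LoebSpace n ω → I) := by
  refine measurable_of_Ioi fun a => ?_
  -- A limit need not keep a strict inequality, hence the margin `1 / (m + 1)`: the limit exceeds
  -- `a` iff, for some `m`, the terms exceed `a` by this margin for `ω`-almost all `k`.
  have h : (St : LoebSpace n ω → I) ⁻¹' Set.Ioi a =
      ⋃ m : ℕ, internalSet ω fun k => upperPart (n k) (a + 1 / ((m : ℝ) + 1)) := by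
    ext z
    induction z using LoebSpace.ind with
    | h x =>
      simp only [Set.mem_preimage, Set.mem_Ioi, Set.mem_iUnion, mk_mem_internalSet, upperPart,
        Finset.mem_filter, Finset.mem_univ, true_and]
      constructor
      · intro h
        have h' : (0 : ℝ) < St (LoebSpace.mk ω x) - a := sub_pos.2 h
        obtain ⟨m, hm⟩ := exists_nat_one_div_lt h'
        exact ⟨m, (tendsto_St x).eventually_const_lt (by linarith)⟩
      · rintro ⟨m, hm⟩
        have h1 : (a : ℝ) + 1 / ((m : ℝ) + 1) ≤ St (LoebSpace.mk ω x) :=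
          ge_of_tendsto (tendsto_St x) (hm.mono fun k hk => hk.le)
        have h2 : (0 : ℝ) < 1 / ((m : ℝ) + 1) := by positivity
        exact Subtype.coe_lt_coe.1 (by linarith)
  rw [h]
  exact MeasurableSet.iUnion fun m => MeasurableSpace.measurableSet_generateFrom ⟨_, rfl⟩

/-- Comparison of distribution functions. The set `St > a` lies in an internal set of density at
most `1 - a`, and `St ≤ a` in one of density at most `a + ε`; as the total mass is `1`, both bounds
are sharp. -/
theorem measurePreserving_St (hω : (ω : Filter ℕ) ≤ cofinite) (hpos : ∀ k, 0 < n k)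
    (hn : Tendsto n atTop atTop) :
    MeasurePreserving (St : LoebSpace n ω → I) (loebMeasure n ω) volume := by
  have := isProbabilityMeasure_loebMeasure hω hpos
  refine ⟨measurable_St, ?_⟩
  have := Measure.isProbabilityMeasure_map (μ := loebMeasure n ω) (f := St) measurable_St.aemeasurable
  refine Measure.ext_of_Iic _ _ fun a => ?_
  rw [unitInterval.volume_Iic]
  have hupper : ((loebMeasure n ω).map St) (Set.Ioi a) ≤ ENNReal.ofReal (1 - a) := by
    rw [Measure.map_apply measurable_St measurableSet_Ioi]
    refine (measure_mono (fun z hz => ?_)).trans ((loebMeasure_internalSet_le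
      fun k => upperPart (n k) a).trans (limDensity_le_ofReal hω hpos hn
        fun k => card_upperPart_le (hpos k) a.2.1 a.2.2))
    induction z using LoebSpace.ind with
    | h x =>
      rw [mk_mem_internalSet]
      simpa [upperPart] using (tendsto_St x).eventually_const_lt (Subtype.coe_lt_coe.2 hz)
  have hlower : ∀ ε > 0, ((loebMeasure n ω).map St) (Set.Iic a) ≤ ENNReal.ofReal (a + ε) := by
    intro ε hε
    rw [Measure.map_apply measurable_St measurableSet_Iic]
    refine (measure_mono (fun z hz => ?_)).trans ((loebMeasure_internalSet_le
      fun k => lowerPart (n k) (a + ε)).trans (limDensity_le_ofReal hω hpos hn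
        fun k => card_lowerPart_le (hpos k) (add_nonneg a.2.1 hε.le)))
    induction z using LoebSpace.ind with
    | h x =>
      rw [mk_mem_internalSet]
      have h1 : (St (LoebSpace.mk ω x) : ℝ) < a + ε :=
        (Subtype.coe_le_coe.2 hz).trans_lt (lt_add_of_pos_right _ hε)
      simpa [lowerPart] using (tendsto_St x).eventually_lt_const h1
  refine le_antisymm ?_ ?_
  · have h1 : Tendsto (fun ε : ℝ => ENNReal.ofReal (a + ε)) (𝓝[>] 0)
        (𝓝 (ENNReal.ofReal (a + 0))) := by
      refine ENNReal.tendsto_ofReal (Tendsto.mono_left ?_ nhdsWithin_le_nhds)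
      exact (continuous_const.add continuous_id).tendsto 0
    rw [add_zero] at h1
    exact ge_of_tendsto h1 (eventually_nhdsWithin_of_forall hlower)
  -- The mass above `a` is at most `1 - a`, which leaves at least `a` for `Set.Iic a`.
  · have h1 := prob_add_prob_compl (μ := (loebMeasure n ω).map St) (measurableSet_Iic (a := a))
    rw [Set.compl_Iic] at h1
    have h2 : ENNReal.ofReal a + ENNReal.ofReal (1 - a) = 1 := by
      rw [← ENNReal.ofReal_add a.2.1 (sub_nonneg.2 a.2.2)]
      simp
    have h3 : ENNReal.ofReal a + ENNReal.ofReal (1 - a) ≤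
        ((loebMeasure n ω).map St) (Set.Iic a) + ENNReal.ofReal (1 - a) := by
      rw [h2, ← h1]
      gcongr
    exact (ENNReal.add_le_add_iff_right ENNReal.ofReal_ne_top).1 h3

/-! ### The action of the universal sofic group -/

/-- The class of a sequence of permutations in the universal sofic group. -/
def SoficGroup.mk (ω : Ultrafilter ℕ) (q : ∀ k, Equiv.Perm (Fin (n k))) : SoficGroup n ω :=
  QuotientGroup.mk (s := hammingNull n ω) q

theorem SoficGroup.ind {P : SoficGroup n ω → Prop} (h : ∀ q, P (SoficGroup.mk ω q)) (p) : P p :=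
  QuotientGroup.induction_on p h

theorem SoficGroup.inv_mk (q : ∀ k, Equiv.Perm (Fin (n k))) :
    (SoficGroup.mk ω q)⁻¹ = SoficGroup.mk ω q⁻¹ := rfl

theorem coeFn_soficAct (q : ∀ k, Equiv.Perm (Fin (n k))) (F : LoebLinfty n ω) :
    soficAct (SoficGroup.mk ω q) F =ᵐ[loebMeasure n ω] fun x => F (loebMap ω q x) :=
  Lp.coeFn_compMeasurePreserving F (measurePreserving_loebMap q)

theorem isRestriction_mk {q : ∀ k, Equiv.Perm (Fin (n k))} {φ : I → I} :
    IsRestriction (SoficGroup.mk ω q) φ ↔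
      ∀ᵐ x ∂(loebMeasure n ω), St (loebMap ω q x) = φ (St x) := Iff.rfl

theorem loebMap_loebMap_inv (q : ∀ k, Equiv.Perm (Fin (n k))) (x : LoebSpace n ω) :
    loebMap ω q (loebMap ω q⁻¹ x) = x := by
  induction x using LoebSpace.ind with
  | h x => simp [loebMap_mk]

theorem loebMap_inv_loebMap (q : ∀ k, Equiv.Perm (Fin (n k))) (x : LoebSpace n ω) :
    loebMap ω q⁻¹ (loebMap ω q x) = x := by
  simpa using loebMap_loebMap_inv q⁻¹ x

theorem ae_loebMap {P : LoebSpace n ω → Prop} (q : ∀ k, Equiv.Perm (Fin (n k)))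
    (h : ∀ᵐ x ∂(loebMeasure n ω), P x) : ∀ᵐ x ∂(loebMeasure n ω), P (loebMap ω q x) :=
  (measurePreserving_loebMap q).quasiMeasurePreserving.ae h

theorem soficAct_soficAct_inv (p : SoficGroup n ω) (F : LoebLinfty n ω) :
    soficAct p (soficAct p⁻¹ F) = F := by
  induction p using SoficGroup.ind with
  | h q =>
    refine Lp.ext ?_
    filter_upwards [coeFn_soficAct q (soficAct (SoficGroup.mk ω q)⁻¹ F),
      ae_loebMap q (coeFn_soficAct q⁻¹ F)] with x h1 h2
    rw [h1, SoficGroup.inv_mk, h2, loebMap_inv_loebMap]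

theorem soficAct_inv_soficAct (p : SoficGroup n ω) (F : LoebLinfty n ω) :
    soficAct p⁻¹ (soficAct p F) = F := by
  simpa using soficAct_soficAct_inv p⁻¹ F

/-- The witness is `f ∘ φ`, taken with a measurable representative of `φ`; its agreement with `φ`
almost everywhere transfers to the Loeb space along `St`. -/
theorem soficAct_mem_StAlg
    (hSt : MeasurePreserving (St : LoebSpace n ω → I) (loebMeasure n ω) volume)
    {p : SoficGroup n ω} {φ : I → I} (hp : IsRestriction p φ) (hφ : IsMeasurePreservingMap φ)
    {F : LoebLinfty n ω} (hF : F ∈ StAlg n ω) : soficAct p F ∈ StAlg n ω := by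
  induction p using SoficGroup.ind with
  | h q =>
    obtain ⟨f, hf⟩ := hF
    obtain ⟨hm, hmap⟩ := hφ
    have hφ' : MeasurePreserving (hm.mk φ) (volume : Measure I) volume :=
      ⟨hm.measurable_mk, (Measure.map_congr hm.ae_eq_mk).symm.trans hmap⟩
    refine ⟨Lp.compMeasurePreserving _ hφ' f, ?_⟩
    filter_upwards [coeFn_soficAct q F, ae_loebMap q hf, isRestriction_mk.1 hp,
      hSt.quasiMeasurePreserving.ae hm.ae_eq_mk,
      hSt.quasiMeasurePreserving.ae (Lp.coeFn_compMeasurePreserving f hφ')] with x h1 h2 h3 h4 h5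
    rw [h1, h2, h3, h5, h4, Function.comp_apply]

/-- Substituting `p⁻¹ x` in `St (p x) = φ (St x)` gives `St x = φ (St (p⁻¹ x))`, and applying `ψ`
gives `St (p⁻¹ x) = ψ (St x)`. -/
theorem inv_mem_GA (hSt : MeasurePreserving (St : LoebSpace n ω → I) (loebMeasure n ω) volume)
    {p : SoficGroup n ω} (hp : p ∈ GA n ω) : p⁻¹ ∈ GA n ω := by
  induction p using SoficGroup.ind with
  | h q =>
    obtain ⟨φ, hr, hφ, ψ, hψ, h1, h2⟩ := hp
    refine ⟨ψ, ?_, hψ, φ, hφ, h2, h1⟩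
    rw [SoficGroup.inv_mk, isRestriction_mk]
    filter_upwards [ae_loebMap q⁻¹ (isRestriction_mk.1 hr),
      ae_loebMap q⁻¹ (hSt.quasiMeasurePreserving.ae h1)] with x h3 h4
    rw [loebMap_loebMap_inv] at h3
    rw [h3, h4]

theorem soficAct_mem_StAlg_of_mem_GA
    (hSt : MeasurePreserving (St : LoebSpace n ω → I) (loebMeasure n ω) volume)
    {p : SoficGroup n ω} (hp : p ∈ GA n ω) {F : LoebLinfty n ω} (hF : F ∈ StAlg n ω) :
    soficAct p F ∈ StAlg n ω := by
  obtain ⟨φ, hr, hφ, -⟩ := hp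
  exact soficAct_mem_StAlg hSt hr hφ hF

/-! ### The coordinate function -/

theorem memLp_coord : MemLp (fun t : I => ((t : ℝ) : ℂ)) ∞ (volume : Measure I) := by
  refine memLp_top_of_bound (C := 1) (Continuous.aestronglyMeasurable (by fun_prop)) ?_
  refine Eventually.of_forall fun t => ?_
  rw [Complex.norm_real, Real.norm_eq_abs, abs_of_nonneg t.2.1]
  exact t.2.2

/-- The element `x ↦ St x` of `L^∞` of the Loeb space. -/
def stElement (hSt : MeasurePreserving (St : LoebSpace n ω → I) (loebMeasure n ω) volume) :
    LoebLinfty n ω :=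
  (memLp_coord.comp_measurePreserving hSt).toLp _

theorem coeFn_stElement
    (hSt : MeasurePreserving (St : LoebSpace n ω → I) (loebMeasure n ω) volume) :
    stElement hSt =ᵐ[loebMeasure n ω] fun x => ((St x : ℝ) : ℂ) :=
  MemLp.coeFn_toLp _

theorem stElement_mem_StAlg
    (hSt : MeasurePreserving (St : LoebSpace n ω → I) (loebMeasure n ω) volume) :
    stElement hSt ∈ StAlg n ω := by
  refine ⟨memLp_coord.toLp _, ?_⟩
  filter_upwards [coeFn_stElement hSt,
    hSt.quasiMeasurePreserving.ae (MemLp.coeFn_toLp memLp_coord)] with x h1 h2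
  rw [h1, h2]

/-- If the image of the coordinate function under the action is a function of the standard part,
then the permutation restricts to a measurable map of the unit interval. -/
theorem exists_measurable_isRestriction
    (hSt : MeasurePreserving (St : LoebSpace n ω → I) (loebMeasure n ω) volume)
    {p : SoficGroup n ω} (h : soficAct p (stElement hSt) ∈ StAlg n ω) :
    ∃ φ : I → I, Measurable φ ∧ IsRestriction p φ := by
  induction p using SoficGroup.ind with
  | h q =>
    obtain ⟨f, hf⟩ := h
    have hfm : AEStronglyMeasurable f (volume : Measure I) := Lp.aestronglyMeasurable f
    -- The function `f` is complex-valued and defined up to null sets. Real part and clamping make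
    -- it a map into `[0,1]` and change nothing at almost every `St x`, where its value is the real
    -- number `St (p x)`.
    refine ⟨fun t => Set.projIcc 0 1 zero_le_one (hfm.mk f t).re,
      continuous_projIcc.measurable.comp
        (Complex.measurable_re.comp hfm.stronglyMeasurable_mk.measurable), ?_⟩
    rw [isRestriction_mk]
    filter_upwards [hf, coeFn_soficAct q (stElement hSt), ae_loebMap q (coeFn_stElement hSt),
      hSt.quasiMeasurePreserving.ae hfm.ae_eq_mk] with x h1 h2 h3 h4
    rw [← h4, ← h1, h2, h3, Complex.ofReal_re, Set.projIcc_val]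

/-- Since `φ ∘ St = St ∘ p` almost everywhere, both push the Loeb measure to the same measure: the
image of Lebesgue measure under `φ` on one side, Lebesgue measure on the other. -/
theorem map_eq_volume_of_isRestriction
    (hSt : MeasurePreserving (St : LoebSpace n ω → I) (loebMeasure n ω) volume)
    {p : SoficGroup n ω} {φ : I → I} (hm : Measurable φ) (hp : IsRestriction p φ) :
    Measure.map φ volume = volume := by
  induction p using SoficGroup.ind with
  | h q =>
    have h1 : Measure.map (φ ∘ St) (loebMeasure n ω) =
        Measure.map (St ∘ loebMap ω q) (loebMeasure n ω) :=
      Measure.map_congr ((isRestriction_mk.1 hp).mono fun x hx => hx.symm)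
    rwa [(hSt.comp (measurePreserving_loebMap q)).map_eq, ← Measure.map_map hm hSt.measurable,
      hSt.map_eq] at h1

/-- At `t = St x` one has `ψ (φ (St x)) = ψ (St (p x)) = St (p⁻¹ (p x)) = St x`. Measurability of
both maps allows the conclusion to descend from the Loeb space to `[0,1]`. -/
theorem comp_ae_eq_id_of_isRestriction
    (hSt : MeasurePreserving (St : LoebSpace n ω → I) (loebMeasure n ω) volume)
    {p : SoficGroup n ω} {φ ψ : I → I} (hφm : Measurable φ) (hψm : Measurable ψ)
    (hφ : IsRestriction p φ) (hψ : IsRestriction p⁻¹ ψ) :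
    ∀ᵐ t ∂(volume : Measure I), ψ (φ t) = t := by
  induction p using SoficGroup.ind with
  | h q =>
    rw [← hSt.map_eq, ae_map_iff hSt.measurable.aemeasurable
      (p := fun t => ψ (φ t) = t) (measurableSet_eq_fun (hψm.comp hφm) measurable_id)]
    filter_upwards [isRestriction_mk.1 hφ, ae_loebMap q (isRestriction_mk.1 hψ)] with x h1 h2
    rw [← h1, ← h2, loebMap_inv_loebMap]

/-- The common criterion behind both converse directions. The test on `p⁻¹` supplies the inverse of
the restriction. -/
theorem mem_GA_of_soficAct_stElement_mem
    (hSt : MeasurePreserving (St : LoebSpace n ω → I) (loebMeasure n ω) volume)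
    {p : SoficGroup n ω} (h1 : soficAct p (stElement hSt) ∈ StAlg n ω)
    (h2 : soficAct p⁻¹ (stElement hSt) ∈ StAlg n ω) : p ∈ GA n ω := by
  obtain ⟨φ, hφm, hφ⟩ := exists_measurable_isRestriction hSt h1
  obtain ⟨ψ, hψm, hψ⟩ := exists_measurable_isRestriction hSt h2
  exact ⟨φ, hφ, ⟨hφm.aemeasurable, map_eq_volume_of_isRestriction hSt hφm hφ⟩, ψ,
    ⟨hψm.aemeasurable, map_eq_volume_of_isRestriction hSt hψm hψ⟩,
    comp_ae_eq_id_of_isRestriction hSt hφm hψm hφ hψ,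
    comp_ae_eq_id_of_isRestriction hSt hψm hφm hψ (by rwa [inv_inv])⟩

theorem mem_GA_iff_image_eq
    (hSt : MeasurePreserving (St : LoebSpace n ω → I) (loebMeasure n ω) volume)
    {p : SoficGroup n ω} : p ∈ GA n ω ↔ soficAct p '' StAlg n ω = StAlg n ω := by
  constructor
  · refine fun hp => Set.Subset.antisymm ?_ fun F hF => ?_
    · rintro _ ⟨F, hF, rfl⟩
      exact soficAct_mem_StAlg_of_mem_GA hSt hp hF
    · exact ⟨_, soficAct_mem_StAlg_of_mem_GA hSt (inv_mem_GA hSt hp) hF,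
        soficAct_soficAct_inv p F⟩
  · intro h
    have hX := stElement_mem_StAlg hSt
    refine mem_GA_of_soficAct_stElement_mem hSt (h ▸ Set.mem_image_of_mem _ hX) ?_
    -- Surjectivity onto the algebra writes the coordinate function as `p F` with `F` in the
    -- algebra, so its image under `p⁻¹` is `F`.
    rw [← h] at hX
    obtain ⟨F, hF, hFX⟩ := hX
    rwa [← hFX, soficAct_inv_soficAct]

/-! ### The tracial ultraproduct -/

theorem loebFunction_mk (d : ∀ k, Fin (n k) → ℂ) (x : ∀ k, Fin (n k)) :
    loebFunction ω d (LoebSpace.mk ω x) = limUnder (ω : Filter ℕ) fun k => d k (x k) := rfl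

theorem tendsto_loebFunction {d : ∀ k, Fin (n k) → ℂ} (hd : ∃ C : ℝ, ∀ k i, ‖d k i‖ ≤ C)
    (x : ∀ k, Fin (n k)) :
    Tendsto (fun k => d k (x k)) (ω : Filter ℕ) (𝓝 (loebFunction ω d (LoebSpace.mk ω x))) := by
  obtain ⟨C, hC⟩ := hd
  obtain ⟨a, -, ha⟩ := (isCompact_closedBall (0 : ℂ) C).ultrafilter_le_nhds
    (ω.map fun k => d k (x k)) (by
      rw [le_principal_iff]
      exact Ultrafilter.mem_map.2 (Eventually.of_forall fun k => by simpa using hC k (x k)))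
  exact tendsto_nhds_limUnder ⟨a, ha⟩

theorem loebFunction_comp_loebMap (d : ∀ k, Fin (n k) → ℂ) (q : ∀ k, Equiv.Perm (Fin (n k)))
    (x : LoebSpace n ω) :
    loebFunction ω d (loebMap ω q x) = loebFunction ω (fun k i => d k (q k i)) x := by
  induction x using LoebSpace.ind with
  | h x => rfl

theorem traceNormSq_diagonal {m : ℕ} (d : Fin m → ℂ) :
    traceNormSq (Matrix.diagonal d) = (∑ i, ‖d i‖ ^ 2) / (m : ℝ) := by
  unfold traceNormSq
  congr 1
  refine Finset.sum_congr rfl fun j _ => ?_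
  rw [Finset.sum_eq_single j (fun i _ hij => by simp [Matrix.diagonal_apply_ne _ hij]) (by simp),
    Matrix.diagonal_apply_eq]

/-- Chebyshev's inequality for the normalised trace. -/
theorem card_div_le_traceNormSq {m : ℕ} (d : Fin m → ℂ) {ε : ℝ} (hε : 0 < ε) :
    (((Finset.univ.filter fun i => ε ≤ ‖d i‖).card : ℝ)) / (m : ℝ) ≤
      (ε ^ 2)⁻¹ * traceNormSq (Matrix.diagonal d) := by
  rw [traceNormSq_diagonal, ← mul_div_assoc]
  gcongr
  rw [inv_mul_eq_div, le_div_iff₀ (by positivity), ← nsmul_eq_mul, ← Finset.sum_const]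
  refine (Finset.sum_le_sum fun i hi => ?_).trans
    (Finset.sum_le_sum_of_subset_of_nonneg (Finset.filter_subset _ _) fun i _ _ => by positivity)
  have := (Finset.mem_filter.1 hi).2
  gcongr

/-- By Chebyshev, the points where `d_k` and `e_k` differ by at least `1 / (m + 1)` have limit
density `0`, so they form a null internal set. Two different limits force membership in one of these
sets. -/
theorem loebFunction_ae_eq {d e : ∀ k, Fin (n k) → ℂ} (hd : ∃ C : ℝ, ∀ k i, ‖d k i‖ ≤ C)
    (he : ∃ C : ℝ, ∀ k i, ‖e k i‖ ≤ C)
    (h : MatrixUltraproduct.mk n ω (diagSeq d hd) = MatrixUltraproduct.mk n ω (diagSeq e he)) :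
    loebFunction ω d =ᵐ[loebMeasure n ω] loebFunction ω e := by
  have h1 : Tendsto (fun k => traceNormSq (Matrix.diagonal fun i => d k i - e k i))
      (ω : Filter ℕ) (𝓝 0) := by
    have h2 : diagSeq d hd - diagSeq e he ∈ traceNull n ω := Ideal.Quotient.eq.1 h
    refine Tendsto.congr (fun k => ?_)
      (show Tendsto (fun k => traceNormSq ((diagSeq d hd - diagSeq e he).1 k)) (ω : Filter ℕ) (𝓝 0)
        from h2)
    congr 1
    exact Matrix.diagonal_sub (d k) (e k)
  have h0 : ∀ m : ℕ, loebMeasure n ω (internalSet ω fun k =>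
      Finset.univ.filter fun i => 1 / ((m : ℝ) + 1) ≤ ‖d k i - e k i‖) = 0 := by
    intro m
    have hm : (0 : ℝ) < 1 / ((m : ℝ) + 1) := by positivity
    refine le_antisymm ((loebMeasure_internalSet_le _).trans (limDensity_eq_zero ?_).le) bot_le
    have h2 := h1.const_mul (((1 / ((m : ℝ) + 1)) ^ 2)⁻¹)
    rw [mul_zero] at h2
    exact squeeze_zero (fun k => by positivity)
      (fun k => card_div_le_traceNormSq (fun i => d k i - e k i) hm) h2
  refine measure_mono_null (fun z hz => ?_) (measure_iUnion_null h0)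
  induction z using LoebSpace.ind with
  | h x =>
    have hne : loebFunction ω d (LoebSpace.mk ω x) - loebFunction ω e (LoebSpace.mk ω x) ≠ 0 :=
      sub_ne_zero.2 hz
    obtain ⟨m, hm⟩ := exists_nat_one_div_lt (norm_pos_iff.2 hne)
    refine Set.mem_iUnion.2 ⟨m, mk_mem_internalSet.2 ?_⟩
    have hlim := ((tendsto_loebFunction (ω := ω) hd x).sub (tendsto_loebFunction (ω := ω) he x)).norm
    filter_upwards [hlim.eventually_const_lt hm] with k hk
    simpa using hk.le

/-- Membership in `diagImage` only provides some representing sequence; this makes it usable for any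
chosen one. -/
theorem mem_of_mk_diagSeq_mem_diagImage {S : Set (LoebLinfty n ω)} {d : ∀ k, Fin (n k) → ℂ}
    {hd : ∃ C : ℝ, ∀ k i, ‖d k i‖ ≤ C} {F : LoebLinfty n ω}
    (h : MatrixUltraproduct.mk n ω (diagSeq d hd) ∈ diagImage S)
    (hF : F =ᵐ[loebMeasure n ω] loebFunction ω d) : F ∈ S := by
  obtain ⟨e, he, hde, G, hG, hGe⟩ := h
  have hFG : F = G := Lp.ext (hF.trans ((loebFunction_ae_eq hd he hde).trans hGe.symm))
  rwa [hFG]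

/-! ### Conjugation by permutation matrices and the normaliser -/

theorem permMatrixHom_mul_diagonal_mul {m : ℕ} (s : Equiv.Perm (Fin m)) (d : Fin m → ℂ) :
    (Matrix.permMatrixHom s * Matrix.diagonal d * Matrix.permMatrixHom s⁻¹ :
      Matrix (Fin m) (Fin m) ℂ) = Matrix.diagonal fun i => d (s⁻¹ i) := by
  ext i j
  simp only [Matrix.permMatrixHom_apply, Equiv.Perm.permMatrix, PEquiv.toMatrix_toPEquiv_mul,
    PEquiv.mul_toMatrix_toPEquiv, Matrix.submatrix_apply, Matrix.diagonal_apply]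
  simp

theorem permUnit_conj_mk_diagSeq (q : ∀ k, Equiv.Perm (Fin (n k))) {d : ∀ k, Fin (n k) → ℂ}
    (hd : ∃ C : ℝ, ∀ k i, ‖d k i‖ ≤ C) :
    (permUnit n ω (SoficGroup.mk ω q) : MatrixUltraproduct n ω) *
        MatrixUltraproduct.mk n ω (diagSeq d hd) *
        ((permUnit n ω (SoficGroup.mk ω q))⁻¹ : (MatrixUltraproduct n ω)ˣ) =
      MatrixUltraproduct.mk n ω (diagSeq (fun k i => d k ((q k)⁻¹ i))
        (hd.imp fun _ hC k _ => hC k _)) := by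
  rw [← map_inv, SoficGroup.inv_mk]
  change MatrixUltraproduct.mk n ω (permSeq n q) * MatrixUltraproduct.mk n ω (diagSeq d hd) *
    MatrixUltraproduct.mk n ω (permSeq n q⁻¹) = _
  rw [← map_mul, ← map_mul]
  congr 1
  ext1
  funext k
  exact permMatrixHom_mul_diagonal_mul (q k) (d k)

/-- The inverse in the hypothesis comes from the conventions: the action composes with `p`, while
conjugation composes the diagonal with `p⁻¹`. -/
theorem permUnit_conj_mem_diagImage {p : SoficGroup n ω} {S T : Set (LoebLinfty n ω)}
    (hST : ∀ F ∈ S, soficAct p⁻¹ F ∈ T) {a : MatrixUltraproduct n ω} (ha : a ∈ diagImage S) :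
    (permUnit n ω p : MatrixUltraproduct n ω) * a *
      ((permUnit n ω p)⁻¹ : (MatrixUltraproduct n ω)ˣ) ∈ diagImage T := by
  induction p using SoficGroup.ind with
  | h q =>
    obtain ⟨d, hd, rfl, F, hF, hFd⟩ := ha
    refine ⟨_, _, permUnit_conj_mk_diagSeq q hd, _, hST F hF, ?_⟩
    filter_upwards [coeFn_soficAct q⁻¹ F, ae_loebMap q⁻¹ hFd] with x h1 h2
    rw [SoficGroup.inv_mk, h1, h2, loebFunction_comp_loebMap]
    rfl

/-- The diagonal sequence of the coordinate functions `i ↦ i / n k` of `{1, ..., n k}`. -/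
def coordSeq (n : ℕ → ℕ) (k : ℕ) (i : Fin (n k)) : ℂ :=
  ((((i : ℕ) + 1 : ℝ) / (n k : ℝ) : ℝ) : ℂ)

theorem coordSeq_bounded (n : ℕ → ℕ) : ∃ C : ℝ, ∀ k i, ‖coordSeq n k i‖ ≤ C := by
  refine ⟨1, fun k i => ?_⟩
  rw [coordSeq, Complex.norm_real, Real.norm_eq_abs, abs_of_nonneg (by positivity)]
  refine div_le_one_of_le₀ ?_ (by positivity)
  exact_mod_cast i.isLt

theorem loebFunction_coordSeq (x : LoebSpace n ω) :
    loebFunction ω (coordSeq n) x = ((St x : ℝ) : ℂ) := by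
  induction x using LoebSpace.ind with
  | h x => exact ((Complex.continuous_ofReal.tendsto _).comp (tendsto_St x)).limUnder_eq

theorem mk_coordSeq_mem_diagImage
    (hSt : MeasurePreserving (St : LoebSpace n ω → I) (loebMeasure n ω) volume) :
    MatrixUltraproduct.mk n ω (diagSeq (coordSeq n) (coordSeq_bounded n)) ∈
      diagImage (StAlg n ω) := by
  refine ⟨_, _, rfl, stElement hSt, stElement_mem_StAlg hSt, ?_⟩
  filter_upwards [coeFn_stElement hSt] with x hx
  rw [hx, loebFunction_coordSeq]

/-- Reads the coordinate test off the matrix side: the conjugated coordinate matrix represents `St ∘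
p⁻¹`. -/
theorem soficAct_inv_stElement_mem
    (hSt : MeasurePreserving (St : LoebSpace n ω → I) (loebMeasure n ω) volume)
    {p : SoficGroup n ω} {S : Set (LoebLinfty n ω)}
    (h : (permUnit n ω p : MatrixUltraproduct n ω) *
      MatrixUltraproduct.mk n ω (diagSeq (coordSeq n) (coordSeq_bounded n)) *
      ((permUnit n ω p)⁻¹ : (MatrixUltraproduct n ω)ˣ) ∈ diagImage S) :
    soficAct p⁻¹ (stElement hSt) ∈ S := by
  induction p using SoficGroup.ind with
  | h q =>
    rw [permUnit_conj_mk_diagSeq] at h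
    refine mem_of_mk_diagSeq_mem_diagImage h ?_
    filter_upwards [coeFn_soficAct q⁻¹ (stElement hSt), ae_loebMap q⁻¹ (coeFn_stElement hSt)]
      with x h1 h2
    rw [SoficGroup.inv_mk, h1, h2, ← loebFunction_coordSeq, loebFunction_comp_loebMap]
    rfl

theorem mem_GA_iff_normalises
    (hSt : MeasurePreserving (St : LoebSpace n ω → I) (loebMeasure n ω) volume)
    {p : SoficGroup n ω} :
    p ∈ GA n ω ↔ Normalises (permUnit n ω p) (diagImage (StAlg n ω)) := by
  constructor
  · intro hp
    have hp' := inv_mem_GA hSt hp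
    refine Set.Subset.antisymm ?_ fun a ha => ?_
    · rintro _ ⟨a, ha, rfl⟩
      exact permUnit_conj_mem_diagImage
        (fun F hF => soficAct_mem_StAlg_of_mem_GA hSt hp' hF) ha
    · refine ⟨_, permUnit_conj_mem_diagImage (p := p⁻¹) (T := StAlg n ω)
        (fun F hF => ?_) ha, ?_⟩
      · rw [inv_inv]
        exact soficAct_mem_StAlg_of_mem_GA hSt hp hF
      · simp [mul_assoc]
  · intro h
    have hX := mk_coordSeq_mem_diagImage hSt
    refine mem_GA_of_soficAct_stElement_mem hSt ?_
      (soficAct_inv_stElement_mem hSt (h.subset (Set.mem_image_of_mem _ hX)))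
    -- The coordinate matrix is `p a p⁻¹` with `a` in the diagonal image, so conjugating it by `p⁻¹`
    -- returns `a`; this is the test for `p` itself.
    obtain ⟨a, ha, hax⟩ := h.superset hX
    rw [← inv_inv p]
    refine soficAct_inv_stElement_mem hSt ?_
    rw [← hax]
    simpa [mul_assoc] using ha

end LoebSofic

end

theorem mainTheorem2 (ω : Ultrafilter ℕ) (hω : (ω : Filter ℕ) ≤ Filter.cofinite)
    (n : ℕ → ℕ) (hpos : ∀ k, 0 < n k) (hn : Filter.Tendsto n Filter.atTop Filter.atTop)
    (p : LoebSofic.SoficGroup n ω) :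
    (p ∈ LoebSofic.GA n ω ↔
      LoebSofic.soficAct p '' LoebSofic.StAlg n ω = LoebSofic.StAlg n ω) ∧
    (p ∈ LoebSofic.GA n ω ↔
      LoebSofic.Normalises (LoebSofic.permUnit n ω p)
        (LoebSofic.diagImage (LoebSofic.StAlg n ω))) :=
  have hSt := LoebSofic.measurePreserving_St hω hpos hn
  ⟨LoebSofic.mem_GA_iff_image_eq hSt, LoebSofic.mem_GA_iff_normalises hSt⟩
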